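/- Semirings have a zero and an identity and need not be commutative; left semimodules over them are unital. A semiring $R$ is called ideal-simple if $\{0\}$ and $R$ are its only two-sided ideals (an ideal being an additive submonoid closed under multiplication by elements of $R$ on both sides), congruence-simple if the diagonal and $R\times R$ are its only congruences (equivalence relations compatible with addition and multiplication), and simple if it is both ideal-simple and congruence-simple. Theorem 5.6. Let $R$ and $S$ be Morita equivalent semirings, that is, semirings whose categories ${}_R\mathcal{M}$ and ${}_S\mathcal{M}$ of left semimodules are equivalent. Then $R$ is congruence-simple if and only if $S$ is; $R$ is ideal-simple if and only if $S$ is; and $R$ is simple if and only if $S$ is. -/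

import Mathlib

open CategoryTheory

universe u v w

/-- A semiring (with `0` and `1`, not necessarily commutative) is *ideal-simple* if `0` and `R` are
its only two-sided ideals. An ideal is an additive submonoid that absorbs multiplication on both
sides; no closure under subtraction is asked for. -/
def IsIdealSimple (R : Type u) [Semiring R] : Prop :=
  ∀ I : Ideal R, I.IsTwoSided → I = ⊥ ∨ I = ⊤

/-- A semiring is *congruence-simple* if the diagonal `⊥` and the universal relation `⊤` are its
only congruences, that is, equivalence relations compatible with addition and multiplication. -/
def IsCongruenceSimple (R : Type u) [Semiring R] : Prop :=
  ∀ c : RingCon R, c = ⊥ ∨ c = ⊤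

/-- A semiring is *simple* if it is both congruence-simple and ideal-simple. -/
def IsSimpleSemiring (R : Type u) [Semiring R] : Prop :=
  IsCongruenceSimple R ∧ IsIdealSimple R

/-- Two semirings are *Morita equivalent* if their categories of (unital) left semimodules are
equivalent. The semimodules range over an arbitrary universe that contains those of `R`
and `S`, so that the regular semimodules belong to the categories up to isomorphism. -/
def MoritaEquivalentSemirings (R : Type u) [Semiring R] (S : Type v) [Semiring S] : Prop :=
  Nonempty (SemimoduleCat.{max u v w} R ≌ SemimoduleCat.{max u v w} S)

/-!
Both kinds of simplicity are read off from endomorphism semirings of semimodules.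

Say that the identity of `B` factors additively through `A` if it is a finite sum of endomorphisms
`B → A → B`. A two-sided ideal (or a congruence) of `End B` is then pulled back to `End A` along
all the maps `x ↦ f ∘ x ∘ g` with `f : A → B` and `g : B → A`. Expanding `y = 1 * y * 1` through
the decomposition of the identity of `B` shows that the ideal (or congruence) is trivial as soon as
its pullback is, so that `End B` inherits simplicity from `End A`
(`IsIdealSimple.end_of_factorsAdditively`, `IsCongruenceSimple.end_of_factorsAdditively`).

Given an equivalence `F` from `R`-semimodules to `S`-semimodules, this is applied to `A = F R` and
`B = S`. The endomorphism semiring of `S` is `Sᵐᵒᵖ`, and that of `F R` is `Rᵐᵒᵖ` because an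
equivalence is additive (`SemimoduleCat.map_add_of_isEquivalence`). The regular semimodule is a
detector, hence so is `F R`. All maps `F R → S` factor through the submodule of `S` spanned by
their images, so this submodule is all of `S`, and a decomposition of the element `1` yields a
decomposition of the identity of `S` (`factorsAdditively_of_isDetector`). Detectors are used rather
than separators because an epimorphism of semimodules need not be surjective.

Simplicity thus passes from `R` to `S`, and the inverse equivalence gives the converse.
-/

/-! ### Invariance under anti-isomorphism -/

section Opposite

variable {R T : Type*} [Semiring R] [Semiring T]

theorem IsIdealSimple.of_op_ringEquiv (hR : IsIdealSimple R) (φ : Rᵐᵒᵖ ≃+* T) :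
    IsIdealSimple T := by
  intro I hI
  let J : Ideal R :=
    { carrier := {x | φ (.op x) ∈ I}
      zero_mem' := by simp
      add_mem' := fun {x y} hx hy ↦ by
        simpa only [Set.mem_ofPred_eq, MulOpposite.op_add, map_add] using I.add_mem hx hy
      smul_mem' := fun r x hx ↦ by
        simpa only [Set.mem_ofPred_eq, smul_eq_mul, MulOpposite.op_mul, map_mul] using
          I.mul_mem_right _ hx }
  have hJ : J.IsTwoSided := ⟨fun {a} b ha ↦ by
    change φ (.op (a * b)) ∈ I
    rw [MulOpposite.op_mul, map_mul]
    exact I.mul_mem_left _ ha⟩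
  have key (t : T) : t ∈ I ↔ (φ.symm t).unop ∈ J := by
    change _ ↔ φ (.op (φ.symm t).unop) ∈ I
    simp
  refine (hR J hJ).imp (fun h ↦ ?_) (fun h ↦ ?_) <;> ext t <;> simp [key, h]

theorem IsCongruenceSimple.of_op_ringEquiv (hR : IsCongruenceSimple R) (φ : Rᵐᵒᵖ ≃+* T) :
    IsCongruenceSimple T := by
  intro c
  have key (x y : T) : c x y ↔ (c.comap φ).unop (φ.symm y).unop (φ.symm x).unop := by
    simp [RingCon.unop_iff, RingCon.comap_rel]
  refine (hR (c.comap φ).unop).imp (fun h ↦ ?_) (fun h ↦ ?_) <;> ext x y <;>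
    simp [key, h, eq_comm]

end Opposite

/-! ### Descent of simplicity between endomorphism semirings -/

section FactorsAdditively

variable {R : Type*} [Semiring R]

/-- The identity of `M` factors additively through `N`: it is a finite sum of endomorphisms of the
form `M → N → M`, which is expressed by membership in the additive submonoid they generate. -/
def FactorsAdditively (R M N : Type*) [Semiring R] [AddCommMonoid M] [AddCommMonoid N]
    [Module R M] [Module R N] : Prop :=
  (1 : Module.End R M) ∈
    AddSubmonoid.closure {p | ∃ (g : M →ₗ[R] N) (h : N →ₗ[R] M), p = h ∘ₗ g}

variable {A B : Type*} [AddCommMonoid A] [AddCommMonoid B] [Module R A] [Module R B]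

/-- An additive relation on `End B` may be tested after composing on both sides with endomorphisms
of `B` that factor through `A`, and these in turn with endomorphisms that factor through `A`. -/
theorem FactorsAdditively.rel_of_forall (hB : FactorsAdditively R B A)
    {r : Module.End R B → Module.End R B → Prop} (zero : r 0 0)
    (add : ∀ {x y x' y'}, r x y → r x' y' → r (x + x') (y + y')) {x y : Module.End R B}
    (h : ∀ (f : B →ₗ[R] A) (f' : A →ₗ[R] B) (g : B →ₗ[R] A) (g' : A →ₗ[R] B),
      r (f' ∘ₗ (f ∘ₗ x ∘ₗ g') ∘ₗ g) (f' ∘ₗ (f ∘ₗ y ∘ₗ g') ∘ₗ g)) : r x y := by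
  have h₁ (f : B →ₗ[R] A) (f' : A →ₗ[R] B) : r ((f' ∘ₗ f) * x * 1) ((f' ∘ₗ f) * y * 1) := by
    refine AddSubmonoid.closure_induction
      (motive := fun q _ ↦ r ((f' ∘ₗ f) * x * q) ((f' ∘ₗ f) * y * q)) ?_ ?_ ?_ hB
    · rintro _ ⟨g, g', rfl⟩
      exact h f f' g g'
    · simpa using zero
    · intro p q _ _ hp hq
      simpa only [mul_add] using add hp hq
  have h₂ : r (1 * x) (1 * y) := by
    refine AddSubmonoid.closure_induction (motive := fun q _ ↦ r (q * x) (q * y)) ?_ ?_ ?_ hB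
    · rintro _ ⟨f, f', rfl⟩
      simpa using h₁ f f'
    · simpa using zero
    · intro p q _ _ hp hq
      simpa only [add_mul] using add hp hq
  simpa using h₂

/-- The two-sided ideal of `End A` formed by the `x` such that `f ∘ x ∘ g` lies in `I` for all
`f : A → B` and `g : B → A`. -/
def Ideal.endTransfer (A : Type*) [AddCommMonoid A] [Module R A] (I : Ideal (Module.End R B)) :
    Ideal (Module.End R A) where
  carrier := {x | ∀ (f : A →ₗ[R] B) (g : B →ₗ[R] A), f ∘ₗ x ∘ₗ g ∈ I}
  zero_mem' f g := by simp
  add_mem' hx hy f g := by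
    simpa only [LinearMap.add_comp, LinearMap.comp_add] using I.add_mem (hx f g) (hy f g)
  smul_mem' a _ hx f g := hx (f ∘ₗ a) g

instance Ideal.isTwoSided_endTransfer (I : Ideal (Module.End R B)) :
    (I.endTransfer A).IsTwoSided :=
  ⟨fun b ha f g ↦ ha f (b ∘ₗ g)⟩

/-- The congruence on `End A` relating `x` and `y` when `c` relates `f ∘ x ∘ g` and `f ∘ y ∘ g` for
all `f : A → B` and `g : B → A`. Its compatibility with multiplication uses transitivity: the
factors are replaced one at a time. -/
def RingCon.endTransfer (A : Type*) [AddCommMonoid A] [Module R A]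
    (c : RingCon (Module.End R B)) : RingCon (Module.End R A) where
  r x y := ∀ (f : A →ₗ[R] B) (g : B →ₗ[R] A), c (f ∘ₗ x ∘ₗ g) (f ∘ₗ y ∘ₗ g)
  iseqv :=
    { refl := fun _ _ _ ↦ c.refl _
      symm := fun h f g ↦ c.symm (h f g)
      trans := fun h h' f g ↦ c.trans (h f g) (h' f g) }
  mul' {_ x y _} h h' f g := c.trans (h f (y ∘ₗ g)) (h' (f ∘ₗ x) g)
  add' h h' f g := by
    simpa only [LinearMap.add_comp, LinearMap.comp_add] using c.add (h f g) (h' f g)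

theorem IsIdealSimple.end_of_factorsAdditively (hs : IsIdealSimple (Module.End R A))
    (hB : FactorsAdditively R B A) : IsIdealSimple (Module.End R B) := by
  intro I hI
  refine (hs (I.endTransfer A) inferInstance).imp (fun h ↦ ?_) (fun h ↦ ?_)
  · refine (Submodule.eq_bot_iff _).2 fun y hy ↦ ?_
    refine hB.rel_of_forall (r := (· = ·)) rfl (fun h h' ↦ congrArg₂ _ h h') fun f f' g g' ↦ ?_
    have : f ∘ₗ y ∘ₗ g' ∈ I.endTransfer A := fun k l ↦
      I.mul_mem_left (k ∘ₗ f) (I.mul_mem_right (g' ∘ₗ l) hy)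
    rw [h, Submodule.mem_bot] at this
    simp [this]
  · refine (Submodule.eq_top_iff').2 fun y ↦ ?_
    refine hB.rel_of_forall (r := fun x _ ↦ x ∈ I) (y := y) I.zero_mem I.add_mem
      fun f f' g g' ↦ ?_
    have : f ∘ₗ y ∘ₗ g' ∈ I.endTransfer A := h ▸ Submodule.mem_top
    exact this f' g

theorem IsCongruenceSimple.end_of_factorsAdditively (hs : IsCongruenceSimple (Module.End R A))
    (hB : FactorsAdditively R B A) : IsCongruenceSimple (Module.End R B) := by
  intro c
  refine (hs (c.endTransfer A)).imp (fun h ↦ ?_) (fun h ↦ ?_)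
  · refine RingCon.ext fun x y ↦ ⟨fun hxy ↦ ?_, fun hxy ↦ ?_⟩
    · refine hB.rel_of_forall (r := (· = ·)) rfl (fun h h' ↦ congrArg₂ _ h h')
        fun f f' g g' ↦ ?_
      have : c.endTransfer A (f ∘ₗ x ∘ₗ g') (f ∘ₗ y ∘ₗ g') := fun k l ↦
        c.mul (c.refl (k ∘ₗ f)) (c.mul hxy (c.refl (g' ∘ₗ l)))
      rw [h, RingCon.coe_bot] at this
      rw [this]
    · obtain rfl : x = y := hxy
      exact c.refl x
  · refine RingCon.ext fun x y ↦ ⟨fun _ ↦ trivial, fun _ ↦ ?_⟩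
    refine hB.rel_of_forall (r := c) (c.refl 0) c.add fun f f' g g' ↦ ?_
    have : c.endTransfer A (f ∘ₗ x ∘ₗ g') (f ∘ₗ y ∘ₗ g') := by
      rw [h]
      trivial
    exact this f' g

end FactorsAdditively

/-! ### Detectors in the category of semimodules -/

section Detector

/-- Equivalences of categories preserve detectors. -/
theorem CategoryTheory.IsDetector.obj_functor {C D : Type*} [Category* C] [Category* D]
    (e : C ≌ D) {G : C} (hG : IsDetector G) : IsDetector (e.functor.obj G) := by
  rw [isDetector_def] at hG ⊢
  intro X Y f hf
  suffices IsIso (e.inverse.map f) from isIso_of_reflects_iso f e.inverse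
  refine hG _ fun h ↦ ?_
  obtain ⟨k, rfl⟩ := (e.toAdjunction.homEquiv _ _).surjective h
  obtain ⟨k', hk', huniq⟩ := hf k
  refine ⟨e.toAdjunction.homEquiv _ _ k', ?_, fun l hl ↦ ?_⟩
  · dsimp only
    rw [← hk']
    exact (e.toAdjunction.homEquiv_naturality_right _ _).symm
  · obtain ⟨l, rfl⟩ := (e.toAdjunction.homEquiv _ _).surjective l
    congr 1
    refine huniq _ ((e.toAdjunction.homEquiv _ _).injective ?_)
    rw [← hl]
    exact e.toAdjunction.homEquiv_naturality_right _ _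

universe r t

variable {R : Type r} [Semiring R]

/-- The linear map from the regular semimodule to `M` taking `1` to `x`. -/
def uliftToSpanSingleton {M : Type*} [AddCommMonoid M] [Module R M] (x : M) :
    ULift.{t} R →ₗ[R] M :=
  LinearMap.toSpanSingleton R M x ∘ₗ ULift.moduleEquiv.toLinearMap

theorem SemimoduleCat.isDetector_regular :
    IsDetector (SemimoduleCat.of.{max r t} R (ULift.{t} R)) := by
  rw [isDetector_def]
  intro X Y f hf
  suffices Function.Bijective f.hom from
    inferInstanceAs (IsIso (LinearEquiv.ofBijective f.hom this).toModuleIsoₛ.hom)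
  constructor
  · intro x y hxy
    have h := (hf (SemimoduleCat.ofHom (uliftToSpanSingleton (f.hom x)))).unique
      (y₁ := SemimoduleCat.ofHom (uliftToSpanSingleton x))
      (y₂ := SemimoduleCat.ofHom (uliftToSpanSingleton y))
      (by ext; simp [uliftToSpanSingleton]) (by ext; simp [uliftToSpanSingleton, hxy])
    simpa [uliftToSpanSingleton] using congrArg (fun k ↦ k.hom (ULift.up 1)) h
  · intro y
    obtain ⟨k, hk, -⟩ := hf (SemimoduleCat.ofHom (uliftToSpanSingleton y))
    refine ⟨k.hom (ULift.up 1), ?_⟩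
    simpa [uliftToSpanSingleton] using congrArg (fun k ↦ k.hom (ULift.up 1)) hk

/-- The images of the maps from a detector span every semimodule: the inclusion of their span
is an isomorphism, since every map from the detector factors through it. -/
theorem SemimoduleCat.iSup_range_eq_top_of_isDetector {P : SemimoduleCat.{t} R}
    (hP : IsDetector P) (M : SemimoduleCat.{t} R) :
    ⨆ f : P →ₗ[R] M, LinearMap.range f = ⊤ := by
  set N := ⨆ f : P →ₗ[R] M, LinearMap.range f with hN
  have hι : IsIso (SemimoduleCat.ofHom N.subtype) := by
    refine hP.def _ fun h ↦ ⟨SemimoduleCat.ofHom (h.hom.codRestrict N fun p ↦ ?_), ?_, ?_⟩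
    · exact Submodule.mem_iSup_of_mem h.hom ⟨p, rfl⟩
    · ext; simp
    · intro k hk
      ext p
      simp [← hk]
  refine (Submodule.eq_top_iff').2 fun m ↦ ?_
  rw [← SemimoduleCat.hom_inv_apply (asIso (SemimoduleCat.ofHom N.subtype)) m]
  exact Subtype.property _

/-- The identity of the regular semimodule factors additively through any detector. -/
theorem factorsAdditively_of_isDetector {P : SemimoduleCat.{max r t} R} (hP : IsDetector P) :
    FactorsAdditively R (ULift.{t} R) P := by
  have hmem : (ULift.up 1 : ULift.{t} R) ∈ ⨆ f : P →ₗ[R] ULift.{t} R, LinearMap.range f := by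
    rw [SemimoduleCat.iSup_range_eq_top_of_isDetector hP (.of R (ULift.{t} R))]
    trivial
  have h1 : (1 : Module.End R (ULift.{t} R)) = uliftToSpanSingleton (ULift.up 1) := by
    ext x
    simp [uliftToSpanSingleton]
  rw [FactorsAdditively, h1]
  refine Submodule.iSup_induction _
    (motive := fun x : ULift.{t} R ↦ (uliftToSpanSingleton x : Module.End R (ULift.{t} R)) ∈
      AddSubmonoid.closure _) hmem ?_ ?_ ?_
  · rintro f _ ⟨p, rfl⟩
    refine AddSubmonoid.subset_closure ⟨uliftToSpanSingleton p, f, ?_⟩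
    ext x
    simp [uliftToSpanSingleton]
  · convert AddSubmonoid.zero_mem _
    ext x
    simp [uliftToSpanSingleton]
  · intro x y hx hy
    convert AddSubmonoid.add_mem _ hx hy
    ext z
    simp [uliftToSpanSingleton]

end Detector

/-! ### Equivalences between categories of semimodules are additive -/

section Additive

universe r s t

variable {R : Type r} [Semiring R] {S : Type s} [Semiring S]
  (F : SemimoduleCat.{t} R ⥤ SemimoduleCat.{t} S)

/-- An equivalence between categories of semimodules is additive. The sum `f + g` is the composite
of a diagonal and a codiagonal map through `M × M`, and `F` preserves the decomposition of the
identity of `M × M` into its two projections, because `F (M × M)` is again a product. -/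
theorem SemimoduleCat.map_add_of_isEquivalence [F.IsEquivalence] {M N : SemimoduleCat.{t} R}
    (f g : M ⟶ N) : F.map (f + g) = F.map f + F.map g := by
  let P : SemimoduleCat.{t} R := .of R (M × M)
  let p₁ : P ⟶ M := ofHom (LinearMap.fst R M M)
  let p₂ : P ⟶ M := ofHom (LinearMap.snd R M M)
  let i₁ : M ⟶ P := ofHom (LinearMap.inl R M M)
  let i₂ : M ⟶ P := ofHom (LinearMap.inr R M M)
  let δ : M ⟶ P := ofHom (LinearMap.prod .id .id)
  let σ : P ⟶ N := ofHom (LinearMap.coprod f.hom g.hom)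
  have comp_add {X Y Z : SemimoduleCat.{t} S} (a : X ⟶ Y) (b c : Y ⟶ Z) :
      a ≫ (b + c) = a ≫ b + a ≫ c := by ext; simp
  have add_comp {X Y Z : SemimoduleCat.{t} S} (a b : X ⟶ Y) (c : Y ⟶ Z) :
      (a + b) ≫ c = a ≫ c + b ≫ c := by ext; simp
  have hi₁p₁ : i₁ ≫ p₁ = 𝟙 M := rfl
  have hi₁p₂ : i₁ ≫ p₂ = 0 := rfl
  have hi₂p₁ : i₂ ≫ p₁ = 0 := rfl
  have hi₂p₂ : i₂ ≫ p₂ = 𝟙 M := rfl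
  have joint {k l : F.obj P ⟶ F.obj P} (h₁ : k ≫ F.map p₁ = l ≫ F.map p₁)
      (h₂ : k ≫ F.map p₂ = l ≫ F.map p₂) : k = l := by
    obtain ⟨k, rfl⟩ := F.map_surjective k
    obtain ⟨l, rfl⟩ := F.map_surjective l
    rw [← F.map_comp, ← F.map_comp] at h₁ h₂
    have h₁ := F.map_injective h₁
    have h₂ := F.map_injective h₂
    congr 1
    exact hom_ext (LinearMap.ext fun x ↦
      Prod.ext (congrArg (fun k ↦ k.hom x) h₁) (congrArg (fun k ↦ k.hom x) h₂))
  have hid : F.map p₁ ≫ F.map i₁ + F.map p₂ ≫ F.map i₂ = 𝟙 (F.obj P) := by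
    apply joint
    · rw [add_comp, Category.assoc, Category.assoc, ← F.map_comp i₁, ← F.map_comp i₂, hi₁p₁, hi₂p₁]
      simp
    · rw [add_comp, Category.assoc, Category.assoc, ← F.map_comp i₁, ← F.map_comp i₂, hi₁p₂, hi₂p₂]
      simp
  have hf : δ ≫ p₁ ≫ i₁ ≫ σ = f := by
    ext x
    change f.hom x + g.hom 0 = f.hom x
    simp
  have hg : δ ≫ p₂ ≫ i₂ ≫ σ = g := by
    ext x
    change f.hom 0 + g.hom x = g.hom x
    simp
  have hfg : δ ≫ σ = f + g := rfl
  calc F.map (f + g)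
      = F.map δ ≫ (F.map p₁ ≫ F.map i₁ + F.map p₂ ≫ F.map i₂) ≫ F.map σ := by
        rw [hid, Category.id_comp, ← F.map_comp, hfg]
    _ = F.map (δ ≫ p₁ ≫ i₁ ≫ σ) + F.map (δ ≫ p₂ ≫ i₂ ≫ σ) := by
        rw [add_comp, comp_add]
        simp only [F.map_comp, Category.assoc]
    _ = F.map f + F.map g := by rw [hf, hg]

/-- An equivalence induces an isomorphism of endomorphism semirings. -/
noncomputable def SemimoduleCat.endRingEquivOfIsEquivalence [F.IsEquivalence]
    (M : SemimoduleCat.{t} R) : Module.End R M ≃+* Module.End S (F.obj M) where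
  toEquiv := homEquiv.symm.trans ((Functor.FullyFaithful.ofFullyFaithful F).homEquiv.trans homEquiv)
  map_add' f g := congrArg Hom.hom (map_add_of_isEquivalence F (ofHom f) (ofHom g))
  map_mul' f g := congrArg Hom.hom (F.map_comp (ofHom g) (ofHom f))

end Additive

/-! ### Morita invariance -/

section Morita

/-- The endomorphism semiring of the regular semimodule is the opposite semiring. -/
noncomputable def opRingEquivEndULift (R : Type u) [Semiring R] :
    Rᵐᵒᵖ ≃+* Module.End R (ULift.{w} R) :=
  (RingEquiv.moduleEndSelf R).trans ULift.moduleEquiv.symm.conjRingEquiv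

/-- The identity of the regular semimodule over `S` factors additively through the image of the
regular semimodule over `R` under an equivalence. -/
theorem CategoryTheory.Equivalence.factorsAdditively_functor_obj {R : Type u} [Semiring R]
    {S : Type v} [Semiring S] (e : SemimoduleCat.{max u v w} R ≌ SemimoduleCat.{max u v w} S) :
    FactorsAdditively S (ULift.{max u w} S)
      (e.functor.obj (.of R (ULift.{max v w} R))) :=
  factorsAdditively_of_isDetector.{v, max u w}
    (SemimoduleCat.isDetector_regular.{u, max v w}.obj_functor e)

theorem IsIdealSimple.of_equivalence {R : Type u} [Semiring R] {S : Type v} [Semiring S]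
    (hR : IsIdealSimple R) (e : SemimoduleCat.{max u v w} R ≌ SemimoduleCat.{max u v w} S) :
    IsIdealSimple S :=
  ((hR.of_op_ringEquiv ((opRingEquivEndULift.{u, max v w} R).trans
    (SemimoduleCat.endRingEquivOfIsEquivalence e.functor (.of R (ULift R))))).end_of_factorsAdditively
      (CategoryTheory.Equivalence.factorsAdditively_functor_obj.{u, v, w} e)).of_op_ringEquiv
    ((opRingEquivEndULift.{v, max u w} S).symm.op.trans (RingEquiv.opOp S).symm)

theorem IsCongruenceSimple.of_equivalence {R : Type u} [Semiring R] {S : Type v} [Semiring S]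
    (hR : IsCongruenceSimple R) (e : SemimoduleCat.{max u v w} R ≌ SemimoduleCat.{max u v w} S) :
    IsCongruenceSimple S :=
  ((hR.of_op_ringEquiv ((opRingEquivEndULift.{u, max v w} R).trans
    (SemimoduleCat.endRingEquivOfIsEquivalence e.functor (.of R (ULift R))))).end_of_factorsAdditively
      (CategoryTheory.Equivalence.factorsAdditively_functor_obj.{u, v, w} e)).of_op_ringEquiv
    ((opRingEquivEndULift.{v, max u w} S).symm.op.trans (RingEquiv.opOp S).symm)

end Morita

theorem theorem5p6 (R : Type u) [Semiring R] (S : Type v) [Semiring S]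
    (h : MoritaEquivalentSemirings.{u, v, w} R S) :
    (IsCongruenceSimple R ↔ IsCongruenceSimple S) ∧
      (IsIdealSimple R ↔ IsIdealSimple S) ∧
      (IsSimpleSemiring R ↔ IsSimpleSemiring S) := by
  obtain ⟨e⟩ := h
  have hc : IsCongruenceSimple R ↔ IsCongruenceSimple S :=
    ⟨fun hR ↦ hR.of_equivalence.{u, v, w} e, fun hS ↦ hS.of_equivalence.{v, u, w} e.symm⟩
  have hi : IsIdealSimple R ↔ IsIdealSimple S :=
    ⟨fun hR ↦ hR.of_equivalence.{u, v, w} e, fun hS ↦ hS.of_equivalence.{v, u, w} e.symm⟩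
  exact ⟨hc, hi, and_congr hc hi⟩
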